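/- For $\lambda\in(0,1)$ and an integer $N\ge 1$ let $$A'_N(\lambda)=\Bigl\{\sum_{n=0}^{N-1}a_n\lambda^n:\ a_n\in\{0,1\}\Bigr\},$$ where every point is counted with multiplicity (the number of its representations), so that $A'_N(\lambda)$ consists of $2^N$ points. Let $x_1\le x_2\le\dots\le x_{2^N}$ be these points listed in non-decreasing order, and let $$g_N(\lambda)=\min_{1\le j<2^N}(x_{j+1}-x_j)$$ be the smallest gap of $A'_N(\lambda)$. **Theorem.** Let $\alpha_N>0$ ($N\ge1$) be real numbers such that $\sum_{N} 3^N\alpha_N<\infty$. Then for Lebesgue-almost every $\lambda\in[\tfrac12,\,0.668]$ we have $g_N(\lambda)>\alpha_N$ for infinitely many $N$. -/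

import Mathlib

noncomputable section

namespace BernoulliGaps

/-- The point `∑_{n=0}^{N-1} a_n λ^n` with digits `a_n ∈ {0,1}`. -/
def digitSum (lam : ℝ) {N : ℕ} (a : Fin N → Fin 2) : ℝ :=
  ∑ n : Fin N, ((a n : ℕ) : ℝ) * lam ^ (n : ℕ)

/-- `A'_N(λ)`, where every point is counted with multiplicity
(as many times as it has representations), so that there are `2^N` points. -/
def pointSet (lam : ℝ) (N : ℕ) : Multiset ℝ :=
  (Finset.univ : Finset (Fin N → Fin 2)).val.map (fun a => digitSum lam a)

/-- The points of `A'_N(λ)`, with multiplicity, listed in non-decreasing order. -/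
def points (lam : ℝ) (N : ℕ) : List ℝ :=
  (pointSet lam N).sort (· ≤ ·)

theorem length_points (lam : ℝ) (N : ℕ) : (points lam N).length = 2 ^ N := by
  simp [points, pointSet]

/-- The gaps (spacings) of `A'_N(λ)`: the differences of consecutive points of the ordered list. -/
def gaps (lam : ℝ) (N : ℕ) : Set ℝ :=
  {d | ∃ (j : ℕ) (h : j + 1 < (points lam N).length),
    d = (points lam N)[j + 1] - (points lam N)[j]}

/-- The smallest gap `g_N(λ)`. For `N ≥ 1` it is a minimum, see `isLeast_smallestGap`
(for `N = 0` there is a single point and no gap). -/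
def smallestGap (lam : ℝ) (N : ℕ) : ℝ := sInf (gaps lam N)

theorem isLeast_smallestGap (lam : ℝ) {N : ℕ} (hN : 1 ≤ N) :
    IsLeast (gaps lam N) (smallestGap lam N) := by
  have hfin : (gaps lam N).Finite := by
    refine (Set.finite_range (fun j : Fin ((points lam N).length - 1) =>
      (points lam N)[(j : ℕ) + 1]'(by omega) - (points lam N)[(j : ℕ)]'(by omega))).subset ?_
    rintro d ⟨j, h, rfl⟩
    exact ⟨⟨j, by omega⟩, rfl⟩
  have hlen : 0 + 1 < (points lam N).length := by
    rw [length_points]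
    exact Nat.one_lt_two_pow (by omega)
  have hne : (gaps lam N).Nonempty := ⟨_, 0, hlen, rfl⟩
  exact ⟨hne.csInf_mem hfin, fun d hd => csInf_le hfin.bddBelow hd⟩

end BernoulliGaps

end

namespace BernoulliGaps

/-! A difference of two points of `A'_N(λ)` is a polynomial `f(λ)` with coefficients in `{-1, 0,
1}`, so a small gap means that some nonzero such `f` is small at `λ`.

The core is `transversality`: on `(1/2, 0.668]`, if the constant term is `±1`, then `|f|` and `|f'|`
are never both at most `10⁻⁸`. Hence `{|f| ≤ ρ}` has measure `O(ρ)`, uniformly in `f`. A leading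
zero only costs a factor `1/λ < 2`, so summing over all words bounds the exceptional set by `O(3^N
ρ)`. Borel–Cantelli with `ρ = α_N` concludes.

Transversality is proved by a finite computation. At a rational `x`, the pair `(f, x f')` determines
the pair of the tail once the first letter is chosen. Every pair coming from a word obeys `|x f' - k
f| ≤ ∑ |n - k| xⁿ` for all `k`. Starting near `(0, 0)` with first letter `1`, every branch of the
tree of letters soon violates such an inequality. -/

/-- The polynomial whose list of coefficients, from the constant term on, is `l`. -/
def wordEval (x : ℝ) : List ℤ → ℝ
  | [] => 0
  | b :: l => b + x * wordEval x l

/-- The derivative of `wordEval`. -/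
def wordDeriv (x : ℝ) : List ℤ → ℝ
  | [] => 0
  | _ :: l => wordEval x l + x * wordDeriv x l

/-- The second derivative of `wordEval`. -/
def wordDeriv₂ (x : ℝ) : List ℤ → ℝ
  | [] => 0
  | _ :: l => 2 * wordDeriv x l + x * wordDeriv₂ x l

/-- All letters are among `-1, 0, 1`. -/
def IsSigned (l : List ℤ) : Prop := ∀ b ∈ l, b = -1 ∨ b = 0 ∨ b = 1

theorem IsSigned.tail {b : ℤ} {l : List ℤ} (h : IsSigned (b :: l)) : IsSigned l :=
  fun c hc => h c (List.mem_cons_of_mem b hc)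

theorem IsSigned.head {b : ℤ} {l : List ℤ} (h : IsSigned (b :: l)) : b = -1 ∨ b = 0 ∨ b = 1 :=
  h b List.mem_cons_self

theorem IsSigned.abs_head_le {b : ℤ} {l : List ℤ} (h : IsSigned (b :: l)) : |(b : ℝ)| ≤ 1 := by
  rcases h.head with rfl | rfl | rfl <;> simp

theorem hasDerivAt_wordEval (l : List ℤ) (x : ℝ) :
    HasDerivAt (fun y => wordEval y l) (wordDeriv x l) x := by
  induction l with
  | nil => exact hasDerivAt_const x (0 : ℝ)
  | cons b l ih =>
    have h := ((hasDerivAt_id x).mul ih).const_add (b : ℝ)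
    simpa [wordEval, wordDeriv] using h

theorem hasDerivAt_wordDeriv (l : List ℤ) (x : ℝ) :
    HasDerivAt (fun y => wordDeriv y l) (wordDeriv₂ x l) x := by
  induction l with
  | nil => exact hasDerivAt_const x (0 : ℝ)
  | cons b l ih =>
    have h : HasDerivAt (fun y => wordEval y l + y * wordDeriv y l)
        (wordDeriv x l + (1 * wordDeriv x l + x * wordDeriv₂ x l)) x :=
      (hasDerivAt_wordEval l x).add ((hasDerivAt_id x).mul ih)
    exact h.congr_deriv (by rw [wordDeriv₂]; ring)

section Bounds

variable {x : ℝ} (hx₀ : 0 ≤ x) (hx₁ : x ≤ 0.668)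
include hx₀ hx₁

/-- Induction step of a geometric series bound: `0.332 = 1 - 0.668`. -/
theorem abs_add_mul_le {u v A B : ℝ} (hu : |u| ≤ A) (hv : |v| ≤ B) (h : A ≤ 0.332 * B) :
    |u + x * v| ≤ B := by
  have hB : 0 ≤ B := (abs_nonneg v).trans hv
  calc |u + x * v| ≤ |u| + |x * v| := abs_add_le _ _
    _ = |u| + x * |v| := by rw [abs_mul, abs_of_nonneg hx₀]
    _ ≤ A + 0.668 * B := by gcongr
    _ ≤ B := by linarith

theorem abs_wordEval_le {l : List ℤ} (hl : IsSigned l) : |wordEval x l| ≤ 3.02 := by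
  induction l with
  | nil => norm_num [wordEval]
  | cons b l ih => exact abs_add_mul_le hx₀ hx₁ hl.abs_head_le (ih hl.tail) (by norm_num)

theorem abs_wordDeriv_le {l : List ℤ} (hl : IsSigned l) : |wordDeriv x l| ≤ 9.1 := by
  induction l with
  | nil => norm_num [wordDeriv]
  | cons b l ih =>
    exact abs_add_mul_le hx₀ hx₁ (abs_wordEval_le hx₀ hx₁ hl.tail) (ih hl.tail) (by norm_num)

theorem abs_wordDeriv₂_le {l : List ℤ} (hl : IsSigned l) : |wordDeriv₂ x l| ≤ 55 := by
  induction l with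
  | nil => norm_num [wordDeriv₂]
  | cons b l ih =>
    refine abs_add_mul_le hx₀ hx₁ (A := 18.2) ?_ (ih hl.tail) (by norm_num)
    have h := abs_wordDeriv_le hx₀ hx₁ hl.tail
    rw [abs_mul, abs_two]
    linarith

end Bounds

/-! ### Linear constraints on the pair `(f, x f')` -/

/-- The supremum of `|x f' - k f|` over all power series `f` with coefficients in `{-1, 0, 1}`. -/
noncomputable def facet (x : ℝ) : ℕ → ℝ
  | 0 => x / (1 - x) ^ 2
  | k + 1 => (k + 1) + x * facet x k

/-- The coefficients of `x f' + k f` are `(n + k) bₙ`. Only `k = 0` is used later, but removing a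
letter raises `k` by one, so the induction needs every `k`. -/
theorem abs_euler_add_le {x : ℝ} (hx₀ : 0 ≤ x) (hx₁ : x < 1) {l : List ℤ} (hl : IsSigned l) (k : ℕ) :
    |x * wordDeriv x l + k * wordEval x l| ≤ k / (1 - x) + x / (1 - x) ^ 2 := by
  have h1 : 0 < 1 - x := by linarith
  induction l generalizing k with
  | nil => simp only [wordDeriv, wordEval, mul_zero, add_zero, abs_zero]; positivity
  | cons b l ih =>
    have hi := ih hl.tail (k + 1)
    push_cast at hi
    calc |x * wordDeriv x (b :: l) + k * wordEval x (b :: l)|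
        = |k * (b : ℝ) + x * (x * wordDeriv x l + (k + 1) * wordEval x l)| := by
          congr 1; simp only [wordDeriv, wordEval]; ring
      _ ≤ |k * (b : ℝ)| + |x * (x * wordDeriv x l + (k + 1) * wordEval x l)| := abs_add_le _ _
      _ = k * |(b : ℝ)| + x * |x * wordDeriv x l + (k + 1) * wordEval x l| := by
          rw [abs_mul, abs_mul, abs_of_nonneg hx₀, Nat.abs_cast]
      _ ≤ k * 1 + x * ((k + 1) / (1 - x) + x / (1 - x) ^ 2) := by
          gcongr
          exact hl.abs_head_le
      _ = k / (1 - x) + x / (1 - x) ^ 2 := by field_simp; ring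

/-- The coefficients are `(n - k) bₙ`, and `facet x k` is `∑ |n - k| xⁿ`; removing a letter lowers
`k` by one. -/
theorem abs_euler_sub_le {x : ℝ} (hx₀ : 0 ≤ x) (hx₁ : x < 1) {l : List ℤ} (hl : IsSigned l) (k : ℕ) :
    |x * wordDeriv x l - k * wordEval x l| ≤ facet x k := by
  induction k generalizing l with
  | zero =>
    have h := abs_euler_add_le hx₀ hx₁ hl 0
    simpa [facet] using h
  | succ k ih =>
    have hf : 0 ≤ facet x k := (abs_nonneg _).trans (ih hl)
    cases l with
    | nil => simp only [wordDeriv, wordEval, mul_zero, sub_zero, abs_zero, facet]; positivity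
    | cons b l =>
      calc |x * wordDeriv x (b :: l) - (k + 1 : ℕ) * wordEval x (b :: l)|
          = |(k + 1) * (-b : ℝ) + x * (x * wordDeriv x l - k * wordEval x l)| := by
            congr 1; simp only [wordDeriv, wordEval]; push_cast; ring
        _ ≤ |(k + 1) * (-b : ℝ)| + |x * (x * wordDeriv x l - k * wordEval x l)| := abs_add_le _ _
        _ = (k + 1) * |(b : ℝ)| + x * |x * wordDeriv x l - k * wordEval x l| := by
            rw [abs_mul, abs_mul, abs_of_nonneg hx₀, abs_neg, abs_of_nonneg (by positivity)]
        _ ≤ (k + 1) * 1 + x * facet x k := by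
            gcongr
            · exact hl.abs_head_le
            · exact ih hl.tail
        _ = facet x (k + 1) := by simp [facet]

/-! ### The search in integer arithmetic and its soundness -/

/-- Whether one of the inequalities `|x f' - j f| ≤ facet x j`, for `k ≤ j < k + n` and `x = p / q`,
fails when `|P f - U| ≤ E` and `|P x f' - W| ≤ H`; here `h` bounds `10 ^ 6 * facet x k`. -/
def violates (p q : ℕ) (U W : ℤ) (E H P : ℕ) : ℕ → ℕ → ℕ → Bool
  | 0, _, _ => false
  | n + 1, k, h =>
    Nat.blt (h * P + 10 ^ 6 * (H + k * E)) (10 ^ 6 * (W - k * U).natAbs) ||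
      violates p q U W E H P n (k + 1) (10 ^ 6 * (k + 1) + p * h / q + 1)

/-- Whether the search, with `fuel` levels and `x = p / q`, finds that no word `l` satisfies
`|P f - U| ≤ E` and `|P x f' - W| ≤ H` for `f = wordEval x l`. -/
def excludes (p q : ℕ) : ℕ → ℤ → ℤ → ℕ → ℕ → ℕ → Bool
  | 0, _, _, _, _, _ => false
  | fuel + 1, U, W, E, H, P =>
    violates p q U W E H P 10 0 (10 ^ 6 * p * q / (q - p) ^ 2 + 1) ||
      (excludes p q fuel ((U + P) * q) (W * q - (U + P) * q) (E * q) (H * q + E * q) (P * p) &&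
      excludes p q fuel (U * q) (W * q - U * q) (E * q) (H * q + E * q) (P * p) &&
      excludes p q fuel ((U - P) * q) (W * q - (U - P) * q) (E * q) (H * q + E * q) (P * p))

/-- Whether the search finds that `f = wordEval y (1 :: l)` has `|f|` or `|f'|` larger than `1 / T`
for all words `l` and all `y` with `|y - p / q| ≤ d / q`. -/
def transversalNear (p q d T : ℕ) : Bool :=
  let E := 55 * d * d * T + 2 * q * q
  let H := p * q + 55 * d * p * T
  let P := q * q * T
  excludes p q 20 ((0 - P) * q) (0 * q - (0 - P) * q) (E * q) (H * q + E * q) (P * p)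

/-- Whether `transversalNear` holds, with `T = 10 ^ 8`, on all intervals `[a / 10000, b / 10000]` with
neighbours `a`, `b` in a list. -/
def transversalCells : List ℕ → Bool
  | a :: b :: l => Nat.ble a b && Nat.ble b 6680 &&
      transversalNear (a + b) 20000 (b - a) (10 ^ 8) && transversalCells (b :: l)
  | _ => true

theorem transversalCells_eq_true :
    transversalCells [5000, 5333, 5733, 6133, 6333, 6433, 6533, 6593, 6623, 6653, 6669, 6677, 6680]
      = true := by
  decide +kernel

theorem natCast_le_mul_div_add_one (m : ℕ) {q : ℕ} (hq : 0 < q) : (m : ℝ) / q ≤ (m / q : ℕ) + 1 := by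
  have h : (m : ℝ) < q * ((m / q : ℕ) + 1) := by exact_mod_cast Nat.lt_mul_div_succ m hq
  rw [div_le_iff₀ (by exact_mod_cast hq)]
  linarith

theorem not_violates {p q : ℕ} (hpq : p < q) {x : ℝ} (hx : x = p / q) {l : List ℤ}
    (hl : IsSigned l) {U W : ℤ} {E H P : ℕ} (hU : |P * wordEval x l - U| ≤ E)
    (hW : |P * (x * wordDeriv x l) - W| ≤ H) (n k h : ℕ) (hh : 10 ^ 6 * facet x k ≤ h) :
    violates p q U W E H P n k h = false := by
  have hq : 0 < q := by omega
  have hq' : (0 : ℝ) < q := by exact_mod_cast hq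
  have hx₀ : 0 ≤ x := by rw [hx]; positivity
  have hx₁ : x < 1 := by rw [hx, div_lt_one hq']; exact_mod_cast hpq
  induction n generalizing k h with
  | zero => rfl
  | succ n ih =>
    rw [violates, Bool.or_eq_false_iff]
    refine ⟨?_, ih _ _ ?_⟩
    · rw [Bool.eq_false_iff, Ne, Nat.blt_eq, not_lt]
      have hf := abs_euler_sub_le hx₀ hx₁ hl k
      have habs : |(W - k * U : ℝ)| ≤ P * facet x k + (H + k * E) := by
        calc |(W - k * U : ℝ)| = |P * (x * wordDeriv x l - k * wordEval x l)
              + (k * (P * wordEval x l - U) - (P * (x * wordDeriv x l) - W))| := by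
              congr 1; ring
          _ ≤ |P * (x * wordDeriv x l - k * wordEval x l)|
              + (|k * (P * wordEval x l - U)| + |P * (x * wordDeriv x l) - W|) :=
            (abs_add_le _ _).trans (by gcongr; exact abs_sub _ _)
          _ = P * |x * wordDeriv x l - k * wordEval x l|
              + (k * |P * wordEval x l - U| + |P * (x * wordDeriv x l) - W|) := by
            rw [abs_mul, abs_mul, Nat.abs_cast, Nat.abs_cast]
          _ ≤ P * facet x k + (k * E + H) := by gcongr
          _ = _ := by ring
      have hcast : (((W - k * U).natAbs : ℕ) : ℝ) = |(W - k * U : ℝ)| := by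
        rw [Nat.cast_natAbs]; push_cast; rfl
      have key : ((10 ^ 6 * (W - k * U).natAbs : ℕ) : ℝ) ≤
          ((h * P + 10 ^ 6 * (H + k * E) : ℕ) : ℝ) := by
        push_cast [hcast]
        nlinarith [mul_le_mul_of_nonneg_right hh (Nat.cast_nonneg (α := ℝ) P)]
      exact_mod_cast key
    · have h1 := natCast_le_mul_div_add_one (p * h) hq
      have h2 : x * (10 ^ 6 * facet x k) ≤ (p * h : ℕ) / q := by
        calc x * (10 ^ 6 * facet x k) ≤ x * h := by gcongr
          _ = _ := by rw [hx]; push_cast; ring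
      rw [facet]
      push_cast at h1 h2 ⊢
      linarith

/-- If `f = b + x g`, then `x g = f - b` and `x (x g') = x f' - (f - b)`. Multiplying by `q` and
replacing the scale `P` by `P p = P q x` keeps everything integral. -/
theorem child_bound {p q : ℕ} (hq : 0 < q) {x : ℝ} (hx : x = p / q) {l : List ℤ}
    {b U W : ℤ} {E H P : ℕ} (hU : |P * wordEval x (b :: l) - U| ≤ E)
    (hW : |P * (x * wordDeriv x (b :: l)) - W| ≤ H) :
    |(P * p : ℕ) * wordEval x l - ((U - b * P) * q : ℤ)| ≤ (E * q : ℕ) ∧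
    |(P * p : ℕ) * (x * wordDeriv x l) - (W * q - (U - b * P) * q : ℤ)| ≤ (H * q + E * q : ℕ) := by
  have hq' : (0 : ℝ) < q := by exact_mod_cast hq
  have hp : (p : ℝ) = x * q := by rw [hx]; field_simp
  have e1 : (P * p : ℕ) * wordEval x l - ((U - b * P) * q : ℤ)
      = (P * wordEval x (b :: l) - U) * q := by
    simp only [wordEval]; push_cast [hp]; ring
  have e2 : (P * p : ℕ) * (x * wordDeriv x l) - (W * q - (U - b * P) * q : ℤ)
      = (P * (x * wordDeriv x (b :: l)) - W) * q - (P * wordEval x (b :: l) - U) * q := by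
    simp only [wordEval, wordDeriv]; push_cast [hp]; ring
  rw [e1, e2]
  constructor
  · rw [abs_mul, Nat.abs_cast]; push_cast; gcongr
  · refine (abs_sub _ _).trans ?_
    rw [abs_mul, abs_mul, Nat.abs_cast]; push_cast; gcongr

theorem not_excludes {p q : ℕ} (hpq : p < q) {x : ℝ} (hx : x = p / q) (fuel : ℕ) {l : List ℤ}
    (hl : IsSigned l) {U W : ℤ} {E H P : ℕ} (hU : |P * wordEval x l - U| ≤ E)
    (hW : |P * (x * wordDeriv x l) - W| ≤ H) :
    excludes p q fuel U W E H P = false := by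
  have hq : 0 < q := by omega
  have hq' : (0 : ℝ) < q := by exact_mod_cast hq
  induction fuel generalizing l U W E H P with
  | zero => rfl
  | succ fuel ih =>
    rw [excludes, Bool.or_eq_false_iff]
    constructor
    · refine not_violates hpq hx hl hU hW _ _ _ ?_
      have h1 := natCast_le_mul_div_add_one (10 ^ 6 * p * q) (q := (q - p) ^ 2)
        (by have : 0 < q - p := by omega
            positivity)
      have h2 : (10 : ℝ) ^ 6 * facet x 0 = (10 ^ 6 * p * q : ℕ) / ((q - p) ^ 2 : ℕ) := by
        have : (0 : ℝ) < q - p := by rw [sub_pos]; exact_mod_cast hpq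
        have h3 : (1 : ℝ) - p / q = (q - p) / q := by field_simp
        rw [facet, hx, h3]
        push_cast [hpq.le]
        field_simp
        ring
      rw [h2]
      push_cast at h1 ⊢
      exact h1
    · obtain ⟨b, l', hl', hb, hU', hW'⟩ : ∃ (b : ℤ) (l' : List ℤ), IsSigned l' ∧
          (b = -1 ∨ b = 0 ∨ b = 1) ∧ |P * wordEval x (b :: l') - U| ≤ E ∧
          |P * (x * wordDeriv x (b :: l')) - W| ≤ H := by
        cases l with
        -- A finished word is continued by zero letters, so it too follows a branch of the search.
        | nil => exact ⟨0, [], hl, by simp, by simpa [wordEval] using hU,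
            by simpa [wordEval, wordDeriv] using hW⟩
        | cons b l => exact ⟨b, l, hl.tail, hl.head, hU, hW⟩
      obtain ⟨h1, h2⟩ := child_bound hq hx hU' hW'
      have h := ih hl' h1 h2
      rcases hb with rfl | rfl | rfl
      · rw [show U - -1 * (P : ℤ) = U + P by ring] at h
        simp [h]
      · rw [show U - 0 * (P : ℤ) = U by ring] at h
        simp [h]
      · rw [show U - 1 * (P : ℤ) = U - P by ring] at h
        simp [h]

/-- Near-tangency at `y` is moved to the centre `x` of the cell using `|f''| ≤ 55`. -/
theorem not_transversalNear {p q d T : ℕ} (hpq : p < q) (hdq : d ≤ q) (hT : 0 < T) {x y : ℝ}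
    (hx : x = p / q) (hx₁ : x ≤ 0.668) (hy₀ : 0 ≤ y) (hy₁ : y ≤ 0.668) (hr : |x - y| ≤ d / q)
    {l : List ℤ} (hl : IsSigned (1 :: l)) (h₀ : |wordEval y (1 :: l)| ≤ 1 / T)
    (h₁ : |wordDeriv y (1 :: l)| ≤ 1 / T) : transversalNear p q d T = false := by
  have hq : 0 < q := by omega
  have hq' : (0 : ℝ) < q := by exact_mod_cast hq
  have hT' : (0 : ℝ) < T := by exact_mod_cast hT
  have hx₀ : 0 ≤ x := by rw [hx]; positivity
  set L := (1 : ℤ) :: l with hL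
  have hmem : ∀ t ∈ Set.uIcc x y, 0 ≤ t ∧ t ≤ 0.668 := fun t ht =>
    ⟨(le_min hx₀ hy₀).trans ht.1, ht.2.trans (max_le hx₁ hy₁)⟩
  have hD : ∀ t ∈ Set.uIcc x y, |wordDeriv t L| ≤ 1 / T + 55 * (d / q) := by
    intro t ht
    have h2 : |wordDeriv t L - wordDeriv y L| ≤ 55 * |t - y| :=
      (convex_uIcc x y).norm_image_sub_le_of_norm_hasDerivWithin_le
        (f := fun s => wordDeriv s L) (f' := fun s => wordDeriv₂ s L)
        (fun s _ => (hasDerivAt_wordDeriv L s).hasDerivWithinAt)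
        (fun s hs => abs_wordDeriv₂_le (hmem s hs).1 (hmem s hs).2 hl) Set.right_mem_uIcc ht
    have h3 : |t - y| ≤ d / q := by
      rw [abs_sub_comm] at hr ⊢
      exact (Set.abs_sub_right_of_mem_uIcc ht).trans hr
    have h4 := abs_sub_abs_le_abs_sub (wordDeriv t L) (wordDeriv y L)
    linarith
  -- Since `f'` is small on the whole segment, the error in `f` is quadratic in the radius `d / q`.
  have hF : |wordEval x L| ≤ 2 * (1 / T) + 55 * (d / q) ^ 2 := by
    have h2 : |wordEval x L - wordEval y L| ≤ (1 / T + 55 * (d / q)) * |x - y| :=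
      (convex_uIcc x y).norm_image_sub_le_of_norm_hasDerivWithin_le
        (f := fun s => wordEval s L) (f' := fun s => wordDeriv s L)
        (fun s _ => (hasDerivAt_wordEval L s).hasDerivWithinAt)
        (fun s hs => hD s hs) Set.right_mem_uIcc Set.left_mem_uIcc
    have h3 : (1 / T + 55 * (d / q)) * |x - y| ≤ (1 / T + 55 * (d / q : ℝ)) * (d / q) := by gcongr
    have h4 := abs_sub_abs_le_abs_sub (wordEval x L) (wordEval y L)
    have h5 : (d : ℝ) / q ≤ 1 := by rw [div_le_one hq']; exact_mod_cast hdq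
    have h6 : 1 / (T : ℝ) * (d / q) ≤ 1 / T := mul_le_of_le_one_right (by positivity) h5
    linarith
  have hU : |(q * q * T : ℕ) * wordEval x L - (0 : ℤ)| ≤ (55 * d * d * T + 2 * q * q : ℕ) := by
    rw [Int.cast_zero, sub_zero, abs_mul, Nat.abs_cast]
    calc ((q * q * T : ℕ) : ℝ) * |wordEval x L|
        ≤ (q * q * T : ℕ) * (2 * (1 / T) + 55 * (d / q) ^ 2) := by gcongr
      _ = (55 * d * d * T + 2 * q * q : ℕ) := by push_cast; field_simp; ring
  have hW : |(q * q * T : ℕ) * (x * wordDeriv x L) - (0 : ℤ)| ≤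
      (p * q + 55 * d * p * T : ℕ) := by
    rw [Int.cast_zero, sub_zero, abs_mul, abs_mul, Nat.abs_cast, abs_of_nonneg hx₀]
    calc ((q * q * T : ℕ) : ℝ) * (x * |wordDeriv x L|)
        ≤ (q * q * T : ℕ) * (x * (1 / T + 55 * (d / q))) := by
          gcongr
          exact hD x Set.left_mem_uIcc
      _ = (p * q + 55 * d * p * T : ℕ) := by rw [hx]; push_cast; field_simp
  obtain ⟨h2, h3⟩ := child_bound hq hx hU hW
  have h4 := not_excludes hpq hx 20 hl.tail h2 h3
  rw [one_mul] at h4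
  exact h4

theorem transversal_of_transversalNear {a b : ℕ} (hab : a ≤ b) (hb : b ≤ 6680)
    (h : transversalNear (a + b) 20000 (b - a) (10 ^ 8) = true) {y : ℝ} (hay : a / 10000 ≤ y)
    (hyb : y ≤ b / 10000) {l : List ℤ} (hl : IsSigned (1 :: l))
    (h₀ : |wordEval y (1 :: l)| ≤ 1 / 10 ^ 8) :
    1 / 10 ^ 8 < |wordDeriv y (1 :: l)| := by
  by_contra! h₁
  have hb' : (b : ℝ) ≤ 6680 := by exact_mod_cast hb
  have ha' : (0 : ℝ) ≤ a := a.cast_nonneg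
  have hab' : (a : ℝ) ≤ b := by exact_mod_cast hab
  rw [not_transversalNear (x := (a + b : ℕ) / (20000 : ℕ)) (y := y) (by omega) (by omega)
    (by norm_num) rfl (by push_cast; linarith) (by linarith) (by linarith) ?_ hl
    (by exact_mod_cast h₀) (by exact_mod_cast h₁)] at h
  · exact Bool.false_ne_true h
  · push_cast [hab]
    rw [abs_le]
    constructor <;> linarith

theorem transversal_of_transversalCells {y : ℝ} {l : List ℤ} (hl : IsSigned (1 :: l))
    (h₀ : |wordEval y (1 :: l)| ≤ 1 / 10 ^ 8) {a : ℕ} {s : List ℕ}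
    (h : transversalCells (a :: s) = true) (ha : a / 10000 < y)
    (hy : y ≤ ((a :: s).getLast (List.cons_ne_nil a s) : ℕ) / 10000) :
    1 / 10 ^ 8 < |wordDeriv y (1 :: l)| := by
  induction s generalizing a with
  | nil => simp at hy; linarith
  | cons b s ih =>
    simp only [transversalCells, Bool.and_eq_true, Nat.ble_eq] at h
    obtain ⟨⟨⟨hab, hb⟩, hc⟩, hs⟩ := h
    rcases le_or_gt y (b / 10000) with hyb | hyb
    · exact transversal_of_transversalNear hab hb hc ha.le hyb hl h₀
    · exact ih hs hyb (by simpa using hy)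

theorem transversality {y : ℝ} (hy₀ : 1 / 2 < y) (hy₁ : y ≤ 0.668) {b : ℤ} {l : List ℤ}
    (hl : IsSigned (b :: l)) (hb : b ≠ 0) (h₀ : |wordEval y (b :: l)| ≤ 1 / 10 ^ 8) :
    1 / 10 ^ 8 < |wordDeriv y (b :: l)| := by
  have key : ∀ l : List ℤ, IsSigned (1 :: l) → |wordEval y (1 :: l)| ≤ 1 / 10 ^ 8 →
      1 / 10 ^ 8 < |wordDeriv y (1 :: l)| := fun l hl h₀ =>
    transversal_of_transversalCells hl h₀ transversalCells_eq_true
      (by norm_num at hy₀ ⊢; exact hy₀) (by norm_num at hy₁ ⊢; exact hy₁)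
  rcases hl.head with rfl | rfl | rfl
  · have hE : ∀ l : List ℤ, wordEval y (l.map Neg.neg) = -wordEval y l := by
      intro l
      induction l with
      | nil => simp [wordEval]
      | cons b l ih => simp only [List.map_cons, wordEval, ih]; push_cast; ring
    have hD : ∀ l : List ℤ, wordDeriv y (l.map Neg.neg) = -wordDeriv y l := by
      intro l
      induction l with
      | nil => simp [wordDeriv]
      | cons b l ih => simp only [List.map_cons, wordDeriv, ih, hE]; ring
    have h := key (l.map Neg.neg)
    rw [show (1 : ℤ) :: l.map Neg.neg = ((-1) :: l).map Neg.neg by simp, hE, hD, abs_neg,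
      abs_neg] at h
    refine h ?_ h₀
    intro c hc
    obtain ⟨e, he, rfl⟩ := List.mem_map.1 hc
    rcases hl e he with rfl | rfl | rfl <;> simp
  · exact absurd rfl hb
  · exact key l hl h₀

/-! ### Measure of the set where a polynomial is small -/

open MeasureTheory Filter

/-- By the mean value theorem, `|f'(c)| |x - y| ≤ 2ρ` for some `c` between. As `|f(c)| ≤ 10⁻⁹ + 9.1
· 10⁻¹⁰ < 10⁻⁸`, transversality applies at `c`. -/
theorem dist_le_of_abs_wordEval_le {x y ρ : ℝ} (hx : x ∈ Set.Ioc (1 / 2 : ℝ) 0.668)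
    (hy : y ∈ Set.Ioc (1 / 2 : ℝ) 0.668) (hxy : |x - y| ≤ 1 / 10 ^ 10) {b : ℤ} {l : List ℤ}
    (hl : IsSigned (b :: l)) (hb : b ≠ 0) (hρ : ρ ≤ 1 / 10 ^ 9)
    (hfx : |wordEval x (b :: l)| ≤ ρ) (hfy : |wordEval y (b :: l)| ≤ ρ) :
    |x - y| ≤ 2 * 10 ^ 8 * ρ := by
  wlog hlt : x < y generalizing x y
  · rcases (not_lt.1 hlt).eq_or_lt with rfl | h
    · have : 0 ≤ ρ := (abs_nonneg _).trans hfx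
      simp only [sub_self, abs_zero]
      positivity
    · rw [abs_sub_comm] at hxy ⊢
      exact this hy hx hxy hfy hfx h
  set L := b :: l with hL
  have hmem : ∀ t ∈ Set.Icc x y, 0 ≤ t ∧ t ≤ 0.668 := fun t ht =>
    ⟨by linarith [hx.1, ht.1], ht.2.trans hy.2⟩
  obtain ⟨c, hc, hslope⟩ := exists_hasDerivAt_eq_slope (fun s => wordEval s L)
    (fun s => wordDeriv s L) hlt
    (fun s _ => (hasDerivAt_wordEval L s).continuousAt.continuousWithinAt)
    (fun s _ => hasDerivAt_wordEval L s)
  have hc' : c ∈ Set.Icc x y := Set.Ioo_subset_Icc_self hc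
  have hfc : |wordEval c L - wordEval x L| ≤ 9.1 * |c - x| :=
    (convex_Icc x y).norm_image_sub_le_of_norm_hasDerivWithin_le
      (f := fun s => wordEval s L) (f' := fun s => wordDeriv s L)
      (fun s _ => (hasDerivAt_wordEval L s).hasDerivWithinAt)
      (fun s hs => abs_wordDeriv_le (hmem s hs).1 (hmem s hs).2 hl)
      (Set.left_mem_Icc.2 hlt.le) hc'
  have hcx : |c - x| ≤ 1 / 10 ^ 10 := by
    rw [abs_sub_comm, abs_of_pos (sub_pos.2 hlt)] at hxy
    rw [abs_of_pos (sub_pos.2 hc.1)]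
    linarith [hc.2]
  have hfc' : |wordEval c L| ≤ 1 / 10 ^ 8 := by
    have := abs_sub_abs_le_abs_sub (wordEval c L) (wordEval x L)
    norm_num at *
    linarith
  have hd := transversality (hx.1.trans hc.1) (hmem c hc').2 hl hb hfc'
  have hyx : 0 < y - x := sub_pos.2 hlt
  have hmul : |wordDeriv c L| * (y - x) ≤ 2 * ρ := by
    calc |wordDeriv c L| * (y - x) = |wordEval y L - wordEval x L| := by
          rw [hslope, abs_div, abs_of_pos hyx]
          field_simp
      _ ≤ |wordEval y L| + |wordEval x L| := abs_sub _ _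
      _ ≤ 2 * ρ := by linarith
  rw [abs_sub_comm, abs_of_pos hyx]
  have : 1 / 10 ^ 8 * (y - x) ≤ 2 * ρ := le_trans (by gcongr) hmul
  linarith

/-- Parameters in `(1/2, 0.668]` at which a polynomial is at most `ρ` in absolute value. -/
def smallSet (l : List ℤ) (ρ : ℝ) : Set ℝ :=
  {x ∈ Set.Ioc (1 / 2 : ℝ) 0.668 | |wordEval x l| ≤ ρ}

theorem volume_smallSet_le {b : ℤ} {l : List ℤ} (hl : IsSigned (b :: l)) (hb : b ≠ 0) {ρ : ℝ}
    (hρ : 0 ≤ ρ) : volume (smallSet (b :: l) ρ) ≤ ENNReal.ofReal (10 ^ 19 * ρ) := by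
  rcases le_or_gt ρ (1 / 10 ^ 9) with h | h
  -- Cut into pieces of length `10⁻¹⁰`; on each the set has diameter at most `2 · 10⁸ ρ`.
  · set s : ℕ → Set ℝ := fun i => {x ∈ smallSet (b :: l) ρ | ⌊x * 10 ^ 10⌋₊ = i} with hs
    have hcover : smallSet (b :: l) ρ ⊆ ⋃ i ∈ Finset.range (10 ^ 10), s i := by
      intro x hx
      simp only [Set.mem_iUnion, Finset.mem_range]
      refine ⟨_, ?_, hx, rfl⟩
      have h1 := hx.1.1
      have h2 := hx.1.2
      rw [Nat.floor_lt (by positivity)]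
      push_cast
      linarith
    have hpiece : ∀ i, volume (s i) ≤ ENNReal.ofReal (2 * 10 ^ 8 * ρ) := by
      intro i
      refine (Real.volume_le_diam _).trans (Metric.ediam_le fun x hx y hy => ?_)
      rw [edist_dist, Real.dist_eq]
      refine ENNReal.ofReal_le_ofReal
        (dist_le_of_abs_wordEval_le hx.1.1 hy.1.1 ?_ hl hb h hx.1.2 hy.1.2)
      have hx0 : 0 ≤ x * 10 ^ 10 := by linarith [hx.1.1.1]
      have hy0 : 0 ≤ y * 10 ^ 10 := by linarith [hy.1.1.1]
      have h1 := Nat.floor_le hx0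
      have h2 := Nat.lt_floor_add_one (x * 10 ^ 10)
      have h3 := Nat.floor_le hy0
      have h4 := Nat.lt_floor_add_one (y * 10 ^ 10)
      rw [hx.2] at h1 h2
      rw [hy.2] at h3 h4
      rw [abs_le]
      constructor <;> linarith
    calc volume (smallSet (b :: l) ρ) ≤ ∑ i ∈ Finset.range (10 ^ 10), volume (s i) :=
          (measure_mono hcover).trans (measure_biUnion_finset_le _ _)
      _ ≤ ∑ i ∈ Finset.range (10 ^ 10), ENNReal.ofReal (2 * 10 ^ 8 * ρ) :=
          Finset.sum_le_sum fun i _ => hpiece i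
      _ = ENNReal.ofReal (10 ^ 10 * (2 * 10 ^ 8 * ρ)) := by
          rw [Finset.sum_const, Finset.card_range, nsmul_eq_mul,
            ENNReal.ofReal_mul (by positivity)]
          norm_num
      _ ≤ ENNReal.ofReal (10 ^ 19 * ρ) := ENNReal.ofReal_le_ofReal (by linarith)
  · calc volume (smallSet (b :: l) ρ) ≤ volume (Set.Ioc (1 / 2 : ℝ) 0.668) :=
          measure_mono fun x hx => hx.1
      _ = ENNReal.ofReal (0.668 - 1 / 2) := Real.volume_Ioc
      _ ≤ ENNReal.ofReal (10 ^ 19 * ρ) := ENNReal.ofReal_le_ofReal (by linarith)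

/-! ### Union over all words -/

/-- All words of length `n` over `{-1, 0, 1}`. -/
def signedWords : ℕ → Finset (List ℤ)
  | 0 => {[]}
  | n + 1 => (({-1, 0, 1} : Finset ℤ) ×ˢ signedWords n).image fun c => c.1 :: c.2

theorem card_signedWords_le (n : ℕ) : (signedWords n).card ≤ 3 ^ n := by
  induction n with
  | zero => simp [signedWords]
  | succ n ih =>
    refine Finset.card_image_le.trans ?_
    rw [Finset.card_product, pow_succ']
    exact Nat.mul_le_mul (by decide) ih

theorem mem_signedWords {n : ℕ} {l : List ℤ} : l ∈ signedWords n ↔ l.length = n ∧ IsSigned l := by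
  induction n generalizing l with
  | zero =>
    simp only [signedWords, Finset.mem_singleton, List.length_eq_zero_iff]
    exact ⟨fun h => ⟨h, by simp [h, IsSigned]⟩, fun h => h.1⟩
  | succ n ih =>
    cases l with
    | nil => simp [signedWords]
    | cons b l => simp [signedWords, ih, IsSigned]; tauto

/-- Parameters in `(1/2, 0.668]` at which some nonzero word of length `N` has absolute value at most
`ρ`. -/
def exceptional (N : ℕ) (ρ : ℝ) : Set ℝ :=
  {x | ∃ l ∈ signedWords N, (∃ b ∈ l, b ≠ 0) ∧ x ∈ smallSet l ρ}

theorem exceptional_zero (ρ : ℝ) : exceptional 0 ρ = ∅ := by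
  ext x
  simp [exceptional, signedWords]

theorem exceptional_succ_subset (N : ℕ) (ρ : ℝ) : exceptional (N + 1) ρ ⊆
    (⋃ c ∈ ({-1, 1} : Finset ℤ) ×ˢ signedWords N, smallSet (c.1 :: c.2) ρ) ∪
      exceptional N (2 * ρ) := by
  rintro x ⟨l, hl, ⟨c, hc, hc0⟩, hx⟩
  rw [mem_signedWords] at hl
  obtain ⟨hlen, hs⟩ := hl
  cases l with
  | nil => simp at hlen
  | cons b l =>
    have hl : l ∈ signedWords N := mem_signedWords.2 ⟨by simpa using hlen, hs.tail⟩
    by_cases hb : b = 0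
    · subst hb
      right
      refine ⟨l, hl, ⟨c, (List.mem_cons.1 hc).resolve_left hc0, hc0⟩, hx.1, ?_⟩
      have h1 := hx.2
      have h2 : 1 / 2 < x := hx.1.1
      simp only [wordEval, Int.cast_zero, zero_add, abs_mul] at h1
      rw [abs_of_pos (by linarith)] at h1
      nlinarith [abs_nonneg (wordEval x l)]
    · left
      simp only [Set.mem_iUnion]
      refine ⟨(b, l), ?_, hx⟩
      have := hs.head
      simp only [Finset.mem_product, Finset.mem_insert, Finset.mem_singleton]
      exact ⟨by tauto, hl⟩

/-- The recursion closes because `2 · 3^N + 2 · (2 · 3^N) = 2 · 3^(N + 1)`: the doubling of `ρ` for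
a leading zero is absorbed by the growth factor `3`. -/
theorem volume_exceptional_le (N : ℕ) {ρ : ℝ} (hρ : 0 ≤ ρ) :
    volume (exceptional N ρ) ≤ ENNReal.ofReal (2 * 10 ^ 19 * (3 ^ N * ρ)) := by
  induction N generalizing ρ with
  | zero => simp [exceptional_zero]
  | succ N ih =>
    have hfirst : volume (⋃ c ∈ ({-1, 1} : Finset ℤ) ×ˢ signedWords N, smallSet (c.1 :: c.2) ρ) ≤
        ENNReal.ofReal (2 * 3 ^ N * (10 ^ 19 * ρ)) := by
      calc _ ≤ ∑ c ∈ ({-1, 1} : Finset ℤ) ×ˢ signedWords N, volume (smallSet (c.1 :: c.2) ρ) :=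
            measure_biUnion_finset_le _ _
        _ ≤ ∑ c ∈ ({-1, 1} : Finset ℤ) ×ˢ signedWords N, ENNReal.ofReal (10 ^ 19 * ρ) := by
            refine Finset.sum_le_sum fun c hc => ?_
            simp only [Finset.mem_product, Finset.mem_insert, Finset.mem_singleton] at hc
            have hs := (mem_signedWords.1 hc.2).2
            refine volume_smallSet_le (fun e he => ?_) (by rcases hc.1 with h | h <;> simp [h]) hρ
            rcases List.mem_cons.1 he with rfl | he
            · tauto
            · exact hs e he
        _ = (2 * (signedWords N).card : ℕ) * ENNReal.ofReal (10 ^ 19 * ρ) := by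
            rw [Finset.sum_const, Finset.card_product, nsmul_eq_mul]
            rfl
        _ ≤ (2 * 3 ^ N : ℕ) * ENNReal.ofReal (10 ^ 19 * ρ) := by
            gcongr
            exact card_signedWords_le N
        _ = ENNReal.ofReal (2 * 3 ^ N * (10 ^ 19 * ρ)) := by
            rw [ENNReal.ofReal_mul (p := 2 * 3 ^ N) (by positivity), ← ENNReal.ofReal_natCast]
            push_cast
            rfl
    calc volume (exceptional (N + 1) ρ)
        ≤ ENNReal.ofReal (2 * 3 ^ N * (10 ^ 19 * ρ)) +
          ENNReal.ofReal (2 * 10 ^ 19 * (3 ^ N * (2 * ρ))) :=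
          (measure_mono (exceptional_succ_subset N ρ)).trans <|
            (measure_union_le _ _).trans (add_le_add hfirst (ih (by positivity)))
      _ = ENNReal.ofReal (2 * 10 ^ 19 * (3 ^ (N + 1) * ρ)) := by
          rw [← ENNReal.ofReal_add (by positivity) (by positivity)]
          congr 1
          ring

/-! ### From polynomials to gaps -/

theorem wordEval_ofFn (x : ℝ) {N : ℕ} (c : Fin N → ℤ) :
    wordEval x (List.ofFn c) = ∑ n : Fin N, (c n : ℝ) * x ^ (n : ℕ) := by
  induction N with
  | zero => simp [wordEval]
  | succ N ih =>
    rw [List.ofFn_succ, wordEval, ih, Fin.sum_univ_succ, Finset.mul_sum]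
    simp only [Fin.val_zero, pow_zero, mul_one, Fin.val_succ, pow_succ]
    congr 1
    exact Finset.sum_congr rfl fun n _ => by ring

theorem lt_abs_digitSum_sub {x ρ : ℝ} (hx : x ∈ Set.Ioc (1 / 2 : ℝ) 0.668) {N : ℕ}
    (hexc : x ∉ exceptional N ρ) {a a' : Fin N → Fin 2} (ha : a ≠ a') :
    ρ < |digitSum x a - digitSum x a'| := by
  by_contra! hle
  obtain ⟨n, hn⟩ := Function.ne_iff.1 ha
  refine hexc ⟨List.ofFn fun n => ((a n : ℕ) : ℤ) - (a' n : ℕ), ?_, ⟨_, List.mem_ofFn.2 ⟨n, rfl⟩, ?_⟩,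
    hx, ?_⟩
  · refine mem_signedWords.2 ⟨List.length_ofFn, fun b hb => ?_⟩
    obtain ⟨m, rfl⟩ := List.mem_ofFn.1 hb
    have h1 := (a m).isLt
    have h2 := (a' m).isLt
    omega
  · intro h
    exact hn (Fin.ext (by omega))
  · have heq : wordEval x (List.ofFn fun n => ((a n : ℕ) : ℤ) - (a' n : ℕ)) =
        digitSum x a - digitSum x a' := by
      rw [wordEval_ofFn]
      unfold digitSum
      rw [← Finset.sum_sub_distrib]
      exact Finset.sum_congr rfl fun n _ => by push_cast; ring
    rwa [heq]

/-- Separation is symmetric, so it passes to the sorted list by permutation; indexing by digit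
sequences accounts for multiplicity. -/
theorem lt_smallestGap {x ρ : ℝ} {N : ℕ} (hN : 1 ≤ N)
    (h : ∀ a a' : Fin N → Fin 2, a ≠ a' → ρ < |digitSum x a - digitSum x a'|) :
    ρ < smallestGap x N := by
  obtain ⟨j, hj, hd⟩ := (isLeast_smallestGap x hN).1
  have hperm : (Finset.univ.toList.map fun a : Fin N → Fin 2 => digitSum x a).Perm (points x N) := by
    rw [← Multiset.coe_eq_coe, points, Multiset.sort_eq, pointSet, ← Multiset.map_coe,
      Finset.coe_toList]
  have hpair : (points x N).Pairwise fun u v => ρ < |u - v| := by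
    refine (hperm.pairwise_iff fun {u v} huv => by rwa [abs_sub_comm]).1 ?_
    exact List.pairwise_map.2 ((Finset.nodup_toList _).imp fun {a a'} haa' => h a a' haa')
  have hsort : (points x N).Pairwise (· ≤ ·) := Multiset.pairwise_sort _ _
  have h1 := List.pairwise_iff_getElem.1 hpair j (j + 1) (by omega) hj (by omega)
  have h2 := List.pairwise_iff_getElem.1 hsort j (j + 1) (by omega) hj (by omega)
  rwa [abs_sub_comm, abs_of_nonneg (sub_nonneg.2 h2), ← hd] at h1

end BernoulliGaps

theorem theorem2p4 (α : ℕ → ℝ) (hα : ∀ N : ℕ, 1 ≤ N → 0 < α N)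
    (hsum : Summable (fun N : ℕ => (3 : ℝ) ^ N * α N)) :
    ∀ᵐ lam ∂(MeasureTheory.volume.restrict (Set.Icc (1 / 2 : ℝ) 0.668)),
      ∃ᶠ N in Filter.atTop, α N < BernoulliGaps.smallestGap lam N := by
  open BernoulliGaps MeasureTheory Filter in
  have hfin : ∑' N, volume (exceptional N (α N)) ≠ ⊤ := by
    have hle : ∀ N, volume (exceptional N (α N)) ≤
        ENNReal.ofReal (2 * 10 ^ 19 * (3 ^ N * α N)) := by
      intro N
      -- The sign of `α 0` is unknown, but no word of length `0` has a nonzero letter.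
      rcases N.eq_zero_or_pos with rfl | hN
      · simp [exceptional_zero]
      · exact volume_exceptional_le N (hα N hN).le
    exact ((ENNReal.tsum_le_tsum hle).trans_lt (hsum.mul_left _).tsum_ofReal_lt_top).ne
  rw [← restrict_Ioc_eq_restrict_Icc, ae_restrict_iff' measurableSet_Ioc]
  filter_upwards [ae_eventually_notMem hfin] with x hx hmem
  -- Borel–Cantelli gives the inequality for all large `N`.
  refine Eventually.frequently ?_
  filter_upwards [hx, eventually_ge_atTop 1] with N hN hN1
  exact lt_smallestGap hN1 fun a a' ha => lt_abs_digitSum_sub hmem hN ha
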